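/- Let $1\le m<n$ be integers. Call a matrix $A\in\mathbb Z^{m\times n}$ with columns $v_1,\dots,v_n$ admissible if (i) the greatest common divisor of all its $m\times m$ minors is $1$, and (ii) $\{x\in\mathbb R^n_{\ge 0}: Ax=0\}=\{0\}$. For such $A$ put $v=v_1+\cdots+v_n$ and $C=\{\lambda_1v_1+\cdots+\lambda_nv_n:\lambda_1,\dots,\lambda_n\ge 0\}$, and let the diagonal Frobenius number $\mathrm g(A)$ be the infimum of all real $t\ge 0$ such that for every $b\in(tv+C)\cap\mathbb Z^m$ there is $z\in\mathbb Z^n_{\ge 0}$ with $Az=b$. Then there exist an infinite sequence of admissible matrices $A_t\in\mathbb Z^{m\times n}$, $t=0,1,2,\dots$, with $\sqrt{\det(A_tA_t^T)}\to\infty$ as $t\to\infty$, and a constant $c'_{m,n}>0$ such that for all $t$ the set of reals defining $\mathrm g(A_t)$ is non-empty and $$\mathrm g(A_t)>c'_{m,n}\sqrt{\det(A_tA_t^T)}.$$ -/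

import Mathlib

/-- An integer vector, viewed as a real vector. -/
def toRealVec {k : ℕ} (z : Fin k → ℤ) : Fin k → ℝ := fun i => (z i : ℝ)

/-- An integer matrix, viewed as a real matrix. -/
def toRealMat {m n : ℕ} (A : Matrix (Fin m) (Fin n) ℤ) : Matrix (Fin m) (Fin n) ℝ :=
  A.map (fun a : ℤ => (a : ℝ))

/-- The knapsack polytope `P(A, b) = {x ∈ ℝⁿ : x ≥ 0, A x = b}`. -/
def knapsackPolytope {m n : ℕ} (A : Matrix (Fin m) (Fin n) ℤ) (b : Fin m → ℤ) :
    Set (Fin n → ℝ) :=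
  {x | (∀ j, 0 ≤ x j) ∧ (toRealMat A).mulVec x = toRealVec b}

/-- The standing assumptions on the input matrix: (i) the `m × m` minors (one for each choice of
`m` columns, in increasing order) have greatest common divisor `1`; (ii) the only nonnegative
real vector in the kernel is `0`. -/
structure IsKnapsackMatrix {m n : ℕ} (A : Matrix (Fin m) (Fin n) ℤ) : Prop where
  gcd_minors : (Finset.univ : Finset (Fin m ↪o Fin n)).gcd
    (fun I => (A.submatrix id I).det) = 1
  nonneg_kernel : {x : Fin n → ℝ | (∀ j, 0 ≤ x j) ∧ (toRealMat A).mulVec x = 0} = {0}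

/-- The set `F(A)` of integer right-hand sides `b` for which `P(A, b)` contains an integer
vector. -/
def feasibleSet {m n : ℕ} (A : Matrix (Fin m) (Fin n) ℤ) : Set (Fin m → ℤ) :=
  {b | ∃ z : Fin n → ℤ, toRealVec z ∈ knapsackPolytope A b}

/-- The cone `C` generated by the columns of `A`. -/
def columnCone {m n : ℕ} (A : Matrix (Fin m) (Fin n) ℤ) : Set (Fin m → ℝ) :=
  {y | ∃ l : Fin n → ℝ, (∀ j, 0 ≤ l j) ∧ y = ∑ j, l j • (toRealMat A).col j}

/-- The sum `v` of the columns of `A`. -/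
def columnSum {m n : ℕ} (A : Matrix (Fin m) (Fin n) ℤ) : Fin m → ℝ :=
  ∑ j, (toRealMat A).col j

/-- The real numbers `t ≥ 0` such that every integer vector in the translated cone `t v + C` is a
feasible right-hand side. -/
def feasibleShifts {m n : ℕ} (A : Matrix (Fin m) (Fin n) ℤ) : Set ℝ :=
  {t | 0 ≤ t ∧ ∀ b : Fin m → ℤ,
    (∃ y ∈ columnCone A, toRealVec b = t • columnSum A + y) → b ∈ feasibleSet A}

/-- The diagonal Frobenius number `g(A)`. It is the infimum, since the least such `t` need not
be attained: for `A = (2 3)` the admissible `t` are exactly those with `t > 1 / 5`. -/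
noncomputable def diagonalFrobenius {m n : ℕ} (A : Matrix (Fin m) (Fin n) ℤ) : ℝ :=
  sInf (feasibleShifts A)

/-! The rows of `blockMatrix` decouple: each row other than the first just fixes one coordinate of
`z`, so feasibility reduces to a one-row Frobenius problem. All weights but k + 1 are multiples of
k, so they represent the same integers as k and k + 1 alone, and k² - k - 1 is not represented
(`not_exists_mul_add_mul_eq`). Let s be the sum of the weights. The first coordinate of the shift by
t is t s, so every t with t s < k² - k - 1 fails, which gives `le_diagonalFrobenius_blockMatrix`.
The rows are orthogonal, so the root of the Gram determinant is the Euclidean norm of the first row,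
between k and s. As s is of order k, both quantities grow linearly in k. -/

/-- The entries of the first row of `blockMatrix`: `k + 1, k, 2 k, …, r k`, followed by zeros. -/
def headWeight (r k j : ℕ) : ℤ :=
  if j = 0 then k + 1 else if j ≤ r then j * k else 0

/-- The block matrix with the row `(k + 1, k, 2 k, …, (n - m) k)` in the upper left corner and
the identity matrix of size `m - 1` in the lower right corner. -/
def blockMatrix (m n k : ℕ) : Matrix (Fin m) (Fin n) ℤ :=
  fun i j => if (i : ℕ) = 0 then headWeight (n - m) k j else if (j : ℕ) = n - m + i then 1 else 0

/-- The column of `blockMatrix` in which row `i ≠ 0` has its only nonzero entry. -/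
def tailColumn {m n : ℕ} (hmn : m < n) (i : Fin m) : Fin n := ⟨n - m + i, by omega⟩

/-! ### Weights of the first row -/

theorem headWeight_nonneg (r k j : ℕ) : 0 ≤ headWeight r k j := by
  unfold headWeight; split_ifs <;> positivity

theorem headWeight_pos {r k j : ℕ} (hk : 0 < k) (hj : j ≤ r) : 0 < headWeight r k j := by
  unfold headWeight; split_ifs <;> positivity

theorem headWeight_of_lt {r k j : ℕ} (hj : r < j) : headWeight r k j = 0 := by
  unfold headWeight; rw [if_neg (by omega), if_neg (by omega)]

theorem headWeight_zero (r k : ℕ) : headWeight r k 0 = k + 1 := by simp [headWeight]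

theorem headWeight_one {r : ℕ} (k : ℕ) (hr : 1 ≤ r) : headWeight r k 1 = k := by
  simp [headWeight, hr]

theorem dvd_headWeight (r k : ℕ) {j : ℕ} (hj : j ≠ 0) : (k : ℤ) ∣ headWeight r k j := by
  unfold headWeight; rw [if_neg hj]; split_ifs <;> simp

theorem headWeight_le {r k j n : ℕ} (hk : 0 < k) (hn : 1 ≤ n) (hr : r ≤ n) :
    headWeight r k j ≤ (n + 1) * k := by
  unfold headWeight
  split_ifs
  · have : 1 ≤ n * k := Nat.mul_pos hn hk
    have : (1 : ℤ) ≤ n * k := by exact_mod_cast this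
    linarith
  · gcongr; omega
  · positivity

theorem sum_smul_col {m n : ℕ} (M : Matrix (Fin m) (Fin n) ℝ) (l : Fin n → ℝ) :
    ∑ j, l j • M.col j = M.mulVec l := by
  ext i; simp [Matrix.mulVec, dotProduct, mul_comm]

theorem columnSum_eq_mulVec {m n : ℕ} (A : Matrix (Fin m) (Fin n) ℤ) :
    columnSum A = (toRealMat A).mulVec 1 := by
  rw [← sum_smul_col]; simp [columnSum]

/-! ### Gram determinant and admissibility -/

section blockMatrix

variable {m n : ℕ} (k : ℕ)

theorem blockMatrix_mulVec_head {i : Fin m} (hi : (i : ℕ) = 0) (x : Fin n → ℝ) :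
    (toRealMat (blockMatrix m n k)).mulVec x i = ∑ j : Fin n, headWeight (n - m) k j * x j := by
  simp [Matrix.mulVec, dotProduct, toRealMat, blockMatrix, hi]

theorem blockMatrix_mulVec_tail (hmn : m < n) {i : Fin m} (hi : (i : ℕ) ≠ 0) (x : Fin n → ℝ) :
    (toRealMat (blockMatrix m n k)).mulVec x i = x (tailColumn hmn i) := by
  have h : ∀ j : Fin n, (j : ℕ) = n - m + i ↔ j = tailColumn hmn i := fun j => by
    simp [tailColumn, Fin.ext_iff]
  simp [Matrix.mulVec, dotProduct, toRealMat, blockMatrix, hi, h]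

theorem blockMatrix_mul_transpose (hmn : m < n) :
    blockMatrix m n k * (blockMatrix m n k).transpose =
      Matrix.diagonal fun i : Fin m =>
        if (i : ℕ) = 0 then ∑ j : Fin n, headWeight (n - m) k j ^ 2 else 1 := by
  have h : ∀ (i : Fin m) (j : Fin n), (j : ℕ) = n - m + i ↔ j = tailColumn hmn i := fun i j => by
    simp [tailColumn, Fin.ext_iff]
  have h0 : ∀ i : Fin m, (i : ℕ) ≠ 0 → headWeight (n - m) k (tailColumn hmn i) = 0 :=
    fun i hi => headWeight_of_lt (by simp only [tailColumn]; omega)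
  ext i i'
  rw [Matrix.mul_apply, Matrix.diagonal_apply]
  simp only [Matrix.transpose_apply, blockMatrix, h]
  by_cases hi : (i : ℕ) = 0 <;> by_cases hi' : (i' : ℕ) = 0
  · have : i = i' := Fin.ext (by omega)
    subst this
    simp [hi, sq]
  · have : i ≠ i' := fun e => hi' (e ▸ hi)
    simp [hi, hi', this, h0]
  · have : i ≠ i' := fun e => hi (e ▸ hi')
    simp [hi, hi', this, h0]
  · have : tailColumn hmn i = tailColumn hmn i' ↔ i = i' := by simp [tailColumn, Fin.ext_iff]
    simp [hi, hi', this, eq_comm]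

theorem prod_ite_val_eq_zero (hm : 1 ≤ m) (c : ℤ) :
    ∏ i : Fin m, (if (i : ℕ) = 0 then c else 1) = c := by
  have h : ∀ i : Fin m, (i : ℕ) = 0 ↔ i = ⟨0, hm⟩ := fun i => by simp [Fin.ext_iff]
  simp [h]

theorem det_blockMatrix_mul_transpose (hm : 1 ≤ m) (hmn : m < n) :
    (blockMatrix m n k * (blockMatrix m n k).transpose).det =
      ∑ j : Fin n, headWeight (n - m) k j ^ 2 := by
  rw [blockMatrix_mul_transpose k hmn, Matrix.det_diagonal, prod_ite_val_eq_zero hm]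

/-- Column `e` together with the tail columns forms a diagonal submatrix. The cases `e = 0, 1` yield
the coprime minors k + 1 and k. -/
theorem exists_minor_eq_headWeight (hm : 1 ≤ m) (hmn : m < n) {e : ℕ} (he : e ≤ n - m) :
    ∃ I : Fin m ↪o Fin n,
      ((blockMatrix m n k).submatrix id I).det = headWeight (n - m) k e := by
  let f : Fin m → Fin n := fun i => if (i : ℕ) = 0 then ⟨e, by omega⟩ else tailColumn hmn i
  have hf : ∀ i, (f i : ℕ) = if (i : ℕ) = 0 then e else n - m + i := fun i => by
    simp only [f]; split_ifs <;> rfl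
  have hmono : StrictMono f := fun i i' h => by
    rw [Fin.lt_def] at h ⊢
    rw [hf, hf]
    split_ifs <;> omega
  refine ⟨OrderEmbedding.ofStrictMono f hmono, ?_⟩
  have : (blockMatrix m n k).submatrix id (OrderEmbedding.ofStrictMono f hmono) =
      Matrix.diagonal fun i : Fin m =>
        if (i : ℕ) = 0 then headWeight (n - m) k e else 1 := by
    ext i i'
    rw [Matrix.diagonal_apply]
    simp only [Matrix.submatrix_apply, id, OrderEmbedding.coe_ofStrictMono, blockMatrix, hf,
      Fin.ext_iff]
    by_cases hi : (i : ℕ) = 0 <;> by_cases hi' : (i' : ℕ) = 0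
    · simp [hi, hi']
    · rw [if_pos hi, if_neg hi', headWeight_of_lt (by omega), if_neg (by omega)]
    · rw [if_neg hi, if_pos hi', if_neg (by omega), if_neg (by omega)]
    · rw [if_neg hi, if_neg hi', if_neg hi]
      split_ifs <;> first | rfl | omega
  rw [this, Matrix.det_diagonal, prod_ite_val_eq_zero hm]

theorem isKnapsackMatrix_blockMatrix (hm : 1 ≤ m) (hmn : m < n) (hk : 0 < k) :
    IsKnapsackMatrix (blockMatrix m n k) where
  gcd_minors := by
    set g := (Finset.univ : Finset (Fin m ↪o Fin n)).gcd
      (fun I => ((blockMatrix m n k).submatrix id I).det)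
    obtain ⟨I, hI⟩ := exists_minor_eq_headWeight k hm hmn (Nat.zero_le (n - m))
    obtain ⟨J, hJ⟩ := exists_minor_eq_headWeight k hm hmn (e := 1) (by omega)
    rw [headWeight_zero] at hI
    rw [headWeight_one k (by omega)] at hJ
    have h1 : g ∣ (k : ℤ) + 1 := hI ▸ Finset.gcd_dvd (Finset.mem_univ I)
    have h2 : g ∣ (k : ℤ) := hJ ▸ Finset.gcd_dvd (Finset.mem_univ J)
    have h3 : g ∣ 1 := (dvd_add_right h2).1 h1
    have h4 : normalize g = g := Finset.normalize_gcd
    exact h4 ▸ normalize_eq_one.2 (isUnit_of_dvd_one h3)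
  nonneg_kernel := by
    ext x
    simp only [Set.mem_ofPred_eq, Set.mem_singleton_iff]
    refine ⟨fun ⟨hx, h⟩ => funext fun j => ?_, fun h => by simp [h]⟩
    by_cases hj : (j : ℕ) ≤ n - m
    · have h0 := congrFun h ⟨0, hm⟩
      rw [blockMatrix_mulVec_head k rfl, Pi.zero_apply, Finset.sum_eq_zero_iff_of_nonneg
        fun j _ => mul_nonneg (Int.cast_nonneg (headWeight_nonneg _ _ _)) (hx j)] at h0
      refine (mul_eq_zero.1 (h0 j (Finset.mem_univ j))).resolve_left ?_
      exact_mod_cast (headWeight_pos hk hj).ne'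
    · have h0 := congrFun h ⟨j - (n - m), by omega⟩
      rw [blockMatrix_mulVec_tail k hmn (by simp only; omega)] at h0
      have hc : tailColumn hmn ⟨j - (n - m), by omega⟩ = j := by
        ext; simp only [tailColumn]; omega
      rwa [hc] at h0

/-! ### The semigroup generated by k and k + 1 -/

theorem exists_mul_add_mul_eq {k b : ℕ} (hk : 0 < k) (hb : k ^ 2 ≤ b) :
    ∃ u w : ℕ, (k + 1) * u + k * w = b := by
  have h1 : b % k < k := Nat.mod_lt _ hk
  have h2 : k ≤ b / k := (Nat.le_div_iff_mul_le hk).2 (by nlinarith)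
  obtain ⟨w, hw⟩ := Nat.exists_eq_add_of_le (h1.le.trans h2)
  -- With b = qk + r and r < k ≤ q, write b = r(k + 1) + (q - r)k.
  refine ⟨b % k, w, ?_⟩
  have := Nat.div_add_mod b k
  rw [hw] at this
  linarith

/-- Modulo k the equation forces u ≡ -1, so u ≥ k - 1, and (k + 1)(k - 1) already exceeds the
target. -/
theorem not_exists_mul_add_mul_eq {k : ℕ} (hk : 0 < k) {u w : ℤ} (hu : 0 ≤ u) (hw : 0 ≤ w) :
    ((k : ℤ) + 1) * u + k * w ≠ k ^ 2 - k - 1 := by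
  intro h
  have hk' : (0 : ℤ) < k := by exact_mod_cast hk
  have hd : (k : ℤ) ∣ u + 1 := ⟨k - 1 - u - w, by linarith⟩
  have := Int.le_of_dvd (by omega) hd
  nlinarith [mul_nonneg hk'.le hw]

/-! ### Bounds on the diagonal Frobenius number -/

theorem one_le_sum_headWeight (hmn : m < n) :
    (1 : ℝ) ≤ ∑ j : Fin n, (headWeight (n - m) k j : ℝ) := by
  have h := Finset.single_le_sum (f := fun j : Fin n => (headWeight (n - m) k j : ℝ))
    (fun j _ => Int.cast_nonneg (headWeight_nonneg _ _ _)) (Finset.mem_univ ⟨0, by omega⟩)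
  refine le_trans ?_ h
  simp [headWeight_zero]

theorem blockMatrix_columnSum_head {i : Fin m} (hi : (i : ℕ) = 0) :
    columnSum (blockMatrix m n k) i = ∑ j : Fin n, (headWeight (n - m) k j : ℝ) := by
  rw [columnSum_eq_mulVec, blockMatrix_mulVec_head k hi]; simp

theorem blockMatrix_columnSum_tail (hmn : m < n) {i : Fin m} (hi : (i : ℕ) ≠ 0) :
    columnSum (blockMatrix m n k) i = 1 := by
  rw [columnSum_eq_mulVec, blockMatrix_mulVec_tail k hmn hi]; simp

theorem mem_feasibleSet_blockMatrix (hm : 1 ≤ m) (hmn : m < n) (hk : 0 < k) {b : Fin m → ℤ}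
    (hb : ∀ i, 0 ≤ b i) (hb0 : (k : ℤ) ^ 2 ≤ b ⟨0, hm⟩) :
    b ∈ feasibleSet (blockMatrix m n k) := by
  obtain ⟨b0, hb0'⟩ := Int.eq_ofNat_of_zero_le (hb ⟨0, hm⟩)
  obtain ⟨u, w, huw⟩ := exists_mul_add_mul_eq (b := b0) hk (by rw [hb0'] at hb0; exact_mod_cast hb0)
  let z : Fin n → ℤ := fun j => if (j : ℕ) = 0 then u else if (j : ℕ) = 1 then w else
    if h : n - m < j then b ⟨j - (n - m), by omega⟩ else 0
  refine ⟨z, fun j => ?_, ?_⟩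
  · simp only [toRealVec, z]
    split_ifs
    · simp
    · simp
    · exact Int.cast_nonneg (hb _)
    · simp
  · ext i
    by_cases hi : (i : ℕ) = 0
    · rw [blockMatrix_mulVec_head k hi]
      have hi0 : i = ⟨0, hm⟩ := Fin.ext hi
      rw [Finset.sum_eq_add (⟨0, by omega⟩ : Fin n) ⟨1, by omega⟩ (by simp)]
      · simp only [toRealVec, z, hi0, hb0', headWeight_zero, headWeight_one k
          (show 1 ≤ n - m by omega), ← huw]
        push_cast
        simp
      · rintro ⟨j, hj⟩ - ⟨h0, h1⟩
        simp only [ne_eq, Fin.mk.injEq] at h0 h1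
        simp only [toRealVec, z, if_neg h0, if_neg h1]
        split_ifs with h
        · simp [headWeight_of_lt h]
        · simp
      · simp
      · simp
    · rw [blockMatrix_mulVec_tail k hmn hi]
      simp only [toRealVec, z, tailColumn]
      rw [if_neg (by omega), if_neg (by omega), dif_pos (by omega)]
      congr 2
      ext; simp

/-- The crude shift k² works because s ≥ 1. Nonemptiness is also what makes the infimum meaningful
in the lower bound. -/
theorem feasibleShifts_blockMatrix_nonempty (hm : 1 ≤ m) (hmn : m < n) (hk : 0 < k) :
    (feasibleShifts (blockMatrix m n k)).Nonempty := by
  refine ⟨(k : ℝ) ^ 2, by positivity, ?_⟩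
  rintro b ⟨y, ⟨l, hl, rfl⟩, hb⟩
  rw [sum_smul_col] at hb
  have h0 : (k : ℝ) ^ 2 ≤ b ⟨0, hm⟩ := by
    have h := congrFun hb ⟨0, hm⟩
    simp only [toRealVec, Pi.add_apply, Pi.smul_apply, smul_eq_mul,
      blockMatrix_columnSum_head k (i := (⟨0, hm⟩ : Fin m)) rfl,
      blockMatrix_mulVec_head k (i := (⟨0, hm⟩ : Fin m)) rfl] at h
    have h1 : 0 ≤ ∑ j : Fin n, (headWeight (n - m) k j : ℝ) * l j := Finset.sum_nonneg
      fun j _ => mul_nonneg (Int.cast_nonneg (headWeight_nonneg _ _ _)) (hl j)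
    have h2 := one_le_sum_headWeight k hmn
    nlinarith [sq_nonneg (k : ℝ)]
  refine mem_feasibleSet_blockMatrix k hm hmn hk (fun i => ?_) (by exact_mod_cast h0)
  by_cases hi : (i : ℕ) = 0
  · obtain rfl : i = ⟨0, hm⟩ := Fin.ext hi
    exact_mod_cast (sq_nonneg (k : ℝ)).trans h0
  · have h := congrFun hb i
    simp only [toRealVec, Pi.add_apply, Pi.smul_apply, smul_eq_mul,
      blockMatrix_columnSum_tail k hmn hi, blockMatrix_mulVec_tail k hmn hi] at h
    have h1 : (0 : ℝ) ≤ b i := by rw [h]; have := hl (tailColumn hmn i); positivity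
    exact_mod_cast h1

theorem notMem_feasibleSet_blockMatrix (hm : 1 ≤ m) (hmn : m < n) (hk : 0 < k) {b : Fin m → ℤ}
    (hb0 : b ⟨0, hm⟩ = (k : ℤ) ^ 2 - k - 1) : b ∉ feasibleSet (blockMatrix m n k) := by
  rintro ⟨z, hz, h⟩
  have hz' : ∀ j, 0 ≤ z j := fun j => Int.cast_nonneg_iff.1 (hz j)
  have h0 := congrFun h ⟨0, hm⟩
  rw [blockMatrix_mulVec_head k rfl] at h0
  simp only [toRealVec, hb0] at h0
  have h1 : ∑ j : Fin n, headWeight (n - m) k j * z j = (k : ℤ) ^ 2 - k - 1 := by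
    exact_mod_cast h0
  rw [← Finset.add_sum_erase _ _ (Finset.mem_univ (⟨0, by omega⟩ : Fin n)), headWeight_zero] at h1
  have hd : (k : ℤ) ∣ ∑ j ∈ Finset.univ.erase (⟨0, by omega⟩ : Fin n),
      headWeight (n - m) k j * z j := Finset.dvd_sum fun j hj =>
    (dvd_headWeight _ _ fun e => Finset.ne_of_mem_erase hj (Fin.ext e)).mul_right _
  have hn : 0 ≤ ∑ j ∈ Finset.univ.erase (⟨0, by omega⟩ : Fin n),
      headWeight (n - m) k j * z j := Finset.sum_nonneg fun j _ =>
    mul_nonneg (headWeight_nonneg _ _ _) (hz' j)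
  obtain ⟨w, hw⟩ := hd
  rw [hw] at h1 hn
  exact not_exists_mul_add_mul_eq hk (hz' _)
    (nonneg_of_mul_nonneg_right hn (by exact_mod_cast hk)) h1

theorem le_diagonalFrobenius_blockMatrix (hm : 1 ≤ m) (hmn : m < n) (hk : 0 < k) :
    ((k : ℝ) ^ 2 - k - 1) / ∑ j : Fin n, (headWeight (n - m) k j : ℝ) ≤
      diagonalFrobenius (blockMatrix m n k) := by
  refine le_csInf (feasibleShifts_blockMatrix_nonempty k hm hmn hk) ?_
  rintro t ⟨ht0, ht⟩
  by_contra! hlt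
  have hs := one_le_sum_headWeight (m := m) (n := n) k hmn
  rw [lt_div_iff₀ (by linarith)] at hlt
  have htk : t ≤ (k : ℝ) ^ 2 := by nlinarith [(Nat.cast_nonneg k : (0 : ℝ) ≤ k)]
  -- The tail entries k² are at least t, so they stay in the shifted cone; column 0 alone absorbs
  -- the slack of the first row.
  let b : Fin m → ℤ := fun i => if (i : ℕ) = 0 then (k : ℤ) ^ 2 - k - 1 else (k : ℤ) ^ 2
  let l : Fin n → ℝ := fun j => if (j : ℕ) = 0 then
      ((k : ℝ) ^ 2 - k - 1 - t * ∑ j : Fin n, (headWeight (n - m) k j : ℝ)) / (k + 1)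
    else if (j : ℕ) ≤ n - m then 0 else (k : ℝ) ^ 2 - t
  refine notMem_feasibleSet_blockMatrix k hm hmn hk (b := b) rfl (ht b ⟨_, ⟨l, ?_, rfl⟩, ?_⟩)
  · intro j
    simp only [l]
    split_ifs
    · exact div_nonneg (by linarith) (by positivity)
    · rfl
    · linarith
  · rw [sum_smul_col]
    ext i
    by_cases hi : (i : ℕ) = 0
    · rw [Pi.add_apply, Pi.smul_apply, blockMatrix_mulVec_head k hi,
        Finset.sum_eq_single (⟨0, by omega⟩ : Fin n), blockMatrix_columnSum_head k hi]
      · simp only [toRealVec, b, l, hi, if_true, headWeight_zero, smul_eq_mul]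
        push_cast
        field_simp
        ring
      · intro j _ hj
        have hj' : (j : ℕ) ≠ 0 := fun e => hj (Fin.ext e)
        simp only [l, if_neg hj']
        split_ifs with h
        · simp
        · simp [headWeight_of_lt (not_le.1 h)]
      · simp
    · rw [Pi.add_apply, Pi.smul_apply, blockMatrix_mulVec_tail k hmn hi,
        blockMatrix_columnSum_tail k hmn hi]
      simp only [toRealVec, b, l, tailColumn, if_neg hi]
      rw [if_neg (by omega), if_neg (by omega)]
      simp

/-! ### Comparison with the determinant -/

theorem sqrt_det_blockMatrix_le (hm : 1 ≤ m) (hmn : m < n) :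
    √(((blockMatrix m n k * (blockMatrix m n k).transpose).det : ℤ) : ℝ) ≤
      ∑ j : Fin n, (headWeight (n - m) k j : ℝ) := by
  rw [det_blockMatrix_mul_transpose k hm hmn]
  refine Real.sqrt_le_iff.2 ⟨by linarith [one_le_sum_headWeight (m := m) (n := n) k hmn], ?_⟩
  push_cast
  exact Finset.sum_sq_le_sq_sum_of_nonneg fun j _ => Int.cast_nonneg (headWeight_nonneg _ _ _)

theorem le_sqrt_det_blockMatrix (hm : 1 ≤ m) (hmn : m < n) :
    (k : ℝ) ≤ √(((blockMatrix m n k * (blockMatrix m n k).transpose).det : ℤ) : ℝ) := by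
  rw [det_blockMatrix_mul_transpose k hm hmn]
  refine Real.le_sqrt_of_sq_le ?_
  have h := Finset.single_le_sum (f := fun j : Fin n => headWeight (n - m) k j ^ 2)
    (fun j _ => sq_nonneg _) (Finset.mem_univ ⟨1, by omega⟩)
  simp only [headWeight_one k (show 1 ≤ n - m by omega)] at h
  exact_mod_cast h

theorem sum_headWeight_le (hmn : m < n) (hk : 0 < k) :
    ∑ j : Fin n, (headWeight (n - m) k j : ℝ) ≤ n * (n + 1) * k := by
  have h : ∀ j ∈ Finset.univ, (headWeight (n - m) k (j : Fin n) : ℝ) ≤ (n + 1) * k := fun j _ => by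
    exact_mod_cast headWeight_le (j := j) hk (by omega) (Nat.sub_le n m)
  simpa [mul_assoc] using Finset.sum_le_card_nsmul _ _ _ h

end blockMatrix

theorem mainTheorem2 (m n : ℕ) (hm : 1 ≤ m) (hmn : m < n) :
    ∃ (A : ℕ → Matrix (Fin m) (Fin n) ℤ) (c : ℝ), 0 < c ∧
      (∀ t, IsKnapsackMatrix (A t)) ∧
      Filter.Tendsto (fun t => Real.sqrt (((A t * (A t).transpose).det : ℤ) : ℝ))
        Filter.atTop Filter.atTop ∧
      ∀ t, (feasibleShifts (A t)).Nonempty ∧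
        c * Real.sqrt (((A t * (A t).transpose).det : ℤ) : ℝ) < diagonalFrobenius (A t) := by
  have hM : (0 : ℝ) < n * (n + 1) := by
    have : (0 : ℝ) < n := by exact_mod_cast (by omega : 0 < n)
    positivity
  -- Taking k = t + 3 ensures k² - k - 1 > k²/4. With M = n(n + 1), the root determinant is at most
  -- Mk and the Frobenius number at least (k² - k - 1)/(Mk), hence the constant 1/(4M²).
  refine ⟨fun t => blockMatrix m n (t + 3), 1 / (4 * (n * (n + 1)) ^ 2), by positivity,
    fun t => isKnapsackMatrix_blockMatrix _ hm hmn (by omega), ?_, fun t =>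
    ⟨feasibleShifts_blockMatrix_nonempty _ hm hmn (by omega), ?_⟩⟩
  · refine Filter.tendsto_atTop_mono (fun t => ?_) tendsto_natCast_atTop_atTop
    refine le_trans ?_ (le_sqrt_det_blockMatrix (t + 3) hm hmn)
    push_cast; linarith
  · refine lt_of_lt_of_le ?_ (le_diagonalFrobenius_blockMatrix (t + 3) hm hmn (by omega))
    have h1 := sqrt_det_blockMatrix_le (t + 3) hm hmn
    have h2 := sum_headWeight_le (m := m) (n := n) (t + 3) hmn (by omega)
    have h3 := one_le_sum_headWeight (m := m) (n := n) (t + 3) hmn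
    have hk : (3 : ℝ) ≤ ((t + 3 : ℕ) : ℝ) := by exact_mod_cast (by omega : 3 ≤ t + 3)
    generalize ((t + 3 : ℕ) : ℝ) = k at *
    generalize ∑ j : Fin n, (headWeight (n - m) (t + 3) j : ℝ) = s at *
    generalize (n : ℝ) * (n + 1) = M at *
    calc _ ≤ 1 / (4 * M ^ 2) * (M * k) := by gcongr; exact h1.trans h2
      _ = (k ^ 2 / 4) / (M * k) := by field_simp
      _ < (k ^ 2 - k - 1) / (M * k) := by gcongr; nlinarith
      _ ≤ _ := div_le_div_of_nonneg_left (by nlinarith) (by linarith) h2
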